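/- Let $G$ be an ample groupoid, that is, a topological groupoid that is étale (the source map is a local homeomorphism onto the unit space $G^{(0)}$) and has a basis of compact open bisections (compact open sets on which the source map $s$ and the range map $r$ are injective). Suppose that $G^{(0)}$ is Hausdorff ($G$ itself need not be Hausdorff). Let $\Gamma$ be a discrete group and let $c\colon G\to\Gamma$ be a continuous cocycle, i.e. $c(xy)=c(x)c(y)$ whenever $s(x)=r(y)$. For $\gamma\in\Gamma$ put $G_\gamma:=c^{-1}(\gamma)$. Let $A(G)=\operatorname{span}_{\mathbb C}\{1_B : B\subseteq G \text{ a compact open bisection}\}$ be the complex Steinberg algebra, with pointwise linear structure and the convolution product $(f*g)(x)=\sum_{r(y)=r(x)}f(y)g(y^{-1}x)$, so that $1_B*1_D=1_{BD}$; let $A(G)_\gamma=\{f\in A(G): f(x)\neq 0\Rightarrow x\in G_\gamma\}$. Let $C^*_r(G)$ be the reduced $C^*$-algebra of $G$, the norm closure of the image of $A(G)$ under the left regular representation $\xi\mapsto f*\xi$ on $\ell^2(G)=\bigoplus_{u\in G^{(0)}}\ell^2(s^{-1}(u))$; let $C^*_r(G)_\gamma=\overline{A(G)_\gamma}$, the closure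 in $C^*_r(G)$ of the image of $A(G)_\gamma$. Then the following are equivalent. 1. $G$ is strongly $\Gamma$-graded: $G_\alpha G_\beta=G_{\alpha\beta}$ for all $\alpha,\beta\in\Gamma$, where $G_\alpha G_\beta=\{xy: x\in G_\alpha,\ y\in G_\beta,\ s(x)=r(y)\}$. 2. $A(G)$ is a strongly $\Gamma$-graded ring with respect to the additive subgroups $A(G)_\gamma$: $A(G)=\bigoplus_{\gamma\in\Gamma}A(G)_\gamma$, and for all $\alpha,\beta\in\Gamma$ the set of finite sums of products $f*g$ with $f\in A(G)_\alpha$, $g\in A(G)_\beta$ is equal to $A(G)_{\alpha\beta}$. 3. $C^*_r(G)$ is a strongly $\Gamma$-graded $C^*$-algebra with respect to the subspaces $C^*_r(G)_\gamma$: these are linearly independent closed subspaces whose algebraic sum is dense in $C^*_r(G)$, and for all $\alpha,\beta,\gamma\in\Gamma$ we have $(C^*_r(G)_\gamma)^*\subseteq C^*_r(G)_{\gamma^{-1}}$, and $\operatorname{span}\{ab: a\in C^*_r(G)_\alpha,\ b\in C^*_r(G)_\beta\}$ is contained and dense in $C^*_r(G)_{\alpha\beta}$. -/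

import Mathlib

/-- A topological groupoid, presented through its space of arrows `G`.  The unit space is the set
of all sources (equivalently, of all ranges).  The product `mul x y` is meaningful only for
composable pairs, i.e. when `src x = rng y`; its values on other pairs are never used. -/
class TopGroupoid (G : Type*) [TopologicalSpace G] where
  src : G → G
  rng : G → G
  mul : G → G → G
  inv : G → G
  src_mul : ∀ x y : G, src x = rng y → src (mul x y) = src y
  rng_mul : ∀ x y : G, src x = rng y → rng (mul x y) = rng x
  mul_assoc : ∀ x y z : G, src x = rng y → src y = rng z →
    mul (mul x y) z = mul x (mul y z)
  src_inv : ∀ x : G, src (inv x) = rng x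
  rng_inv : ∀ x : G, rng (inv x) = src x
  inv_mul : ∀ x : G, mul (inv x) x = src x
  mul_inv : ∀ x : G, mul x (inv x) = rng x
  mul_src : ∀ x : G, mul x (src x) = x
  rng_self_mul : ∀ x : G, mul (rng x) x = x
  continuousOn_mul : ContinuousOn (fun p : G × G => mul p.1 p.2) {p : G × G | src p.1 = rng p.2}
  continuous_inv : Continuous inv

namespace TopGroupoid

section Algebraic

variable {G : Type*} [TopologicalSpace G] [TopGroupoid G]

theorem src_src (x : G) : src (src x) = src x := by
  have h := src_mul (inv x) x (src_inv x)
  rwa [inv_mul] at h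

theorem rng_src (x : G) : rng (src x) = src x := by
  have h := rng_mul (inv x) x (src_inv x)
  rwa [inv_mul, rng_inv] at h

theorem src_rng (x : G) : src (rng x) = rng x := by
  have h := src_mul x (inv x) (rng_inv x).symm
  rwa [mul_inv, src_inv] at h

theorem inv_inv (x : G) : inv (inv x) = x := by
  have h1 : src (inv (inv x)) = rng (inv x) := src_inv _
  have h2 : src (inv (inv x)) = src x := by rw [src_inv, rng_inv]
  have h3 := mul_assoc (inv (inv x)) (inv x) x h1 (src_inv x)
  rw [inv_mul (inv x), inv_mul x, src_inv, rng_self_mul, ← h2, mul_src] at h3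
  exact h3.symm

theorem inv_mul_cancel_left (x y : G) (h : src x = rng y) : mul (inv x) (mul x y) = y := by
  rw [← mul_assoc (inv x) x y (src_inv x) h, inv_mul, h, rng_self_mul]

theorem mul_inv_cancel_left (x y : G) (h : rng x = rng y) : mul x (mul (inv x) y) = y := by
  rw [← mul_assoc x (inv x) y (rng_inv x).symm (by rw [src_inv, h]), mul_inv, h, rng_self_mul]

theorem inv_mul_rev (x y : G) (h : src x = rng y) :
    inv (mul x y) = mul (inv y) (inv x) := by
  have hc : src (inv y) = rng (inv x) := by rw [src_inv, rng_inv, h]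
  have h1 : mul (mul x y) (mul (inv y) (inv x)) = rng x := by
    rw [mul_assoc x y _ h (by rw [rng_mul _ _ hc, rng_inv]),
      mul_inv_cancel_left y (inv x) (by rw [rng_inv, h]), mul_inv]
  have h2 := inv_mul_cancel_left (mul x y) (mul (inv y) (inv x))
    (by rw [src_mul _ _ h, rng_mul _ _ hc, rng_inv])
  rw [h1] at h2
  have h3 : rng x = src (inv (mul x y)) := by rw [src_inv, rng_mul _ _ h]
  rw [h3, mul_src] at h2
  exact h2

theorem continuous_src : Continuous (src : G → G) := by
  have h : (src : G → G) = fun x => mul (inv x) x := funext fun x => (inv_mul x).symm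
  rw [h]
  exact continuousOn_mul.comp_continuous (f := fun x : G => (inv x, x))
    (continuous_inv.prodMk continuous_id) fun x => src_inv x

theorem continuous_rng : Continuous (rng : G → G) := by
  have h : (rng : G → G) = fun x => src (inv x) := funext fun x => (src_inv x).symm
  rw [h]
  exact continuous_src.comp continuous_inv

end Algebraic

/-- The unit space of the groupoid, with the subspace topology. -/
def units (G : Type*) [TopologicalSpace G] [TopGroupoid G] : Set G := Set.range (src : G → G)

section Bisections

variable {G : Type*} [TopologicalSpace G] [TopGroupoid G]

/-- The source map, with values in the unit space. -/
def srcUnit (x : G) : units G := ⟨src x, x, rfl⟩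

/-- The groupoid product of two sets of arrows. -/
def setMul (B D : Set G) : Set G :=
  {z | ∃ x ∈ B, ∃ y ∈ D, src x = rng y ∧ z = mul x y}

/-- The set of inverses of a set of arrows. -/
def setInv (B : Set G) : Set G := {z | inv z ∈ B}

/-- A compact open bisection: a compact open set of arrows on which source and range are
injective.  (Compact means quasi-compact; in an etale groupoid source and range then restrict
to homeomorphisms from the set onto open subsets of the unit space.) -/
structure IsCompactOpenBisection (B : Set G) : Prop where
  isCompact : IsCompact B
  isOpen : IsOpen B
  injOn_src : Set.InjOn src B
  injOn_rng : Set.InjOn rng B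

end Bisections

/-- An ample groupoid: the source map is a local homeomorphism onto the (open) unit space
(the groupoid is etale), and the compact open bisections form a basis of the topology. -/
class IsAmple (G : Type*) [TopologicalSpace G] [TopGroupoid G] : Prop where
  isLocalHomeomorph_srcUnit : IsLocalHomeomorph (srcUnit : G → units G)
  isTopologicalBasis : TopologicalSpace.IsTopologicalBasis {B : Set G | IsCompactOpenBisection B}

section BisectionOperations

variable {G : Type*} [TopologicalSpace G] [TopGroupoid G]

theorem IsCompactOpenBisection.setInv {B : Set G} (hB : IsCompactOpenBisection B) :
    IsCompactOpenBisection (setInv B) where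
  isCompact := by
    have h : TopGroupoid.setInv B = inv '' B := by
      ext z
      exact ⟨fun hz => ⟨inv z, hz, inv_inv z⟩, by
        rintro ⟨y, hy, rfl⟩
        simpa [TopGroupoid.setInv, inv_inv] using hy⟩
    rw [h]
    exact hB.isCompact.image continuous_inv
  isOpen := hB.isOpen.preimage continuous_inv
  injOn_src := by
    intro x hx y hy h
    have := hB.injOn_rng hx hy (by rw [rng_inv, rng_inv, h])
    rw [← inv_inv x, this, inv_inv]
  injOn_rng := by
    intro x hx y hy h
    have := hB.injOn_src hx hy (by rw [src_inv, src_inv, h])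
    rw [← inv_inv x, this, inv_inv]

theorem isOpen_rng_saturation [IsAmple G] {U : Set G} (hU : IsOpen U) :
    IsOpen {x : G | ∃ y ∈ U, rng y = rng x} := by
  have hcont : Continuous (fun x : G => srcUnit (inv x)) :=
    (continuous_src.comp continuous_inv).subtype_mk _
  have hopen : IsOpen (srcUnit '' (setInv U) : Set (units G)) :=
    (IsAmple.isLocalHomeomorph_srcUnit (G := G)).isOpenMap _ (hU.preimage continuous_inv)
  have h : {x : G | ∃ y ∈ U, rng y = rng x}
      = (fun x : G => srcUnit (inv x)) ⁻¹' (srcUnit '' (setInv U)) := by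
    ext x
    constructor
    · rintro ⟨y, hy, h⟩
      refine ⟨inv y, by simpa [setInv, inv_inv] using hy, Subtype.ext ?_⟩
      simp only [srcUnit, src_inv, h]
    · rintro ⟨z, hz, h⟩
      refine ⟨inv z, hz, ?_⟩
      have := congrArg Subtype.val h
      simp only [srcUnit, src_inv] at this
      rw [rng_inv, this]
  rw [h]
  exact hopen.preimage hcont

theorem mem_setMul_iff {B D : Set G} {x : G} :
    x ∈ setMul B D ↔ ∃ y ∈ B, rng y = rng x ∧ mul (inv y) x ∈ D := by
  constructor
  · rintro ⟨b, hb, d, hd, h, rfl⟩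
    exact ⟨b, hb, (rng_mul b d h).symm, by rwa [inv_mul_cancel_left b d h]⟩
  · rintro ⟨y, hy, h, hd⟩
    refine ⟨y, hy, _, hd, ?_, (mul_inv_cancel_left y x h).symm⟩
    rw [rng_mul _ _ (by rw [src_inv, h]), rng_inv]

theorem IsCompactOpenBisection.setMul [IsAmple G] [T2Space (units G)] {B D : Set G}
    (hB : IsCompactOpenBisection B) (hD : IsCompactOpenBisection D) :
    IsCompactOpenBisection (setMul B D) where
  isCompact := by
    have hcl : IsClosed {p : G × G | src p.1 = rng p.2} := by
      have h1 : Continuous (fun p : G × G => srcUnit p.1) :=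
        (continuous_src.comp continuous_fst).subtype_mk _
      have h2 : Continuous (fun p : G × G => srcUnit (inv p.2)) :=
        ((continuous_src.comp continuous_inv).comp continuous_snd).subtype_mk _
      have h := isClosed_eq h1 h2
      have he : {p : G × G | src p.1 = rng p.2}
          = {p : G × G | srcUnit p.1 = srcUnit (inv p.2)} := by
        ext p
        have hi := src_inv p.2
        constructor
        · intro (hp : src p.1 = rng p.2)
          exact Subtype.ext (hp.trans hi.symm)
        · intro hp
          exact (congrArg Subtype.val hp).trans hi
      rw [he]
      exact h
    have hK : IsCompact ((B ×ˢ D) ∩ {p : G × G | src p.1 = rng p.2}) :=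
      (hB.isCompact.prod hD.isCompact).inter_right hcl
    have h : TopGroupoid.setMul B D
        = (fun p : G × G => mul p.1 p.2) '' ((B ×ˢ D) ∩ {p : G × G | src p.1 = rng p.2}) := by
      ext z
      constructor
      · rintro ⟨b, hb, d, hd, h, rfl⟩
        exact ⟨(b, d), ⟨⟨hb, hd⟩, h⟩, rfl⟩
      · rintro ⟨⟨b, d⟩, ⟨⟨hb, hd⟩, h⟩, rfl⟩
        exact ⟨b, hb, d, hd, h, rfl⟩
    rw [h]
    exact hK.image_of_continuousOn (continuousOn_mul.mono Set.inter_subset_right)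
  isOpen := by
    rw [isOpen_iff_mem_nhds]
    intro x hx
    obtain ⟨y, hy, hyx, hd⟩ := mem_setMul_iff.1 hx
    have hc : ContinuousOn (fun p : G × G => mul (inv p.1) p.2)
        {p : G × G | rng p.1 = rng p.2} := by
      refine continuousOn_mul.comp (f := fun p : G × G => (inv p.1, p.2))
        ((continuous_inv.comp continuous_fst).prodMk continuous_snd).continuousOn ?_
      intro p hp
      simpa [src_inv] using hp
    obtain ⟨W, hW, hWeq⟩ := (continuousOn_iff'.1 hc) D hD.isOpen
    have hyxW : (y, x) ∈ W :=
      (hWeq ▸ (⟨hd, hyx⟩ : (y, x) ∈ (fun p : G × G => mul (inv p.1) p.2) ⁻¹' D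
        ∩ {p : G × G | rng p.1 = rng p.2}) :
        (y, x) ∈ W ∩ {p : G × G | rng p.1 = rng p.2}).1
    obtain ⟨U, V, hU, hV, hyU, hxV, hUV⟩ := isOpen_prod_iff.1 hW y x hyxW
    have hN : IsOpen (V ∩ {x : G | ∃ z ∈ U ∩ B, rng z = rng x}) :=
      hV.inter (isOpen_rng_saturation (hU.inter hB.isOpen))
    refine Filter.mem_of_superset (hN.mem_nhds ⟨hxV, y, ⟨hyU, hy⟩, hyx⟩) ?_
    rintro x' ⟨hx'V, z, ⟨hzU, hzB⟩, hz⟩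
    refine mem_setMul_iff.2 ⟨z, hzB, hz, ?_⟩
    have : (z, x') ∈ W ∩ {p : G × G | rng p.1 = rng p.2} := ⟨hUV ⟨hzU, hx'V⟩, hz⟩
    rw [← hWeq] at this
    exact this.1
  injOn_src := by
    rintro _ ⟨b, hb, d, hd, h, rfl⟩ _ ⟨b', hb', d', hd', h', rfl⟩ he
    rw [src_mul _ _ h, src_mul _ _ h'] at he
    obtain rfl := hD.injOn_src hd hd' he
    obtain rfl := hB.injOn_src hb hb' (h.trans h'.symm)
    rfl
  injOn_rng := by
    rintro _ ⟨b, hb, d, hd, h, rfl⟩ _ ⟨b', hb', d', hd', h', rfl⟩ he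
    rw [rng_mul _ _ h, rng_mul _ _ h'] at he
    obtain rfl := hB.injOn_rng hb hb' he
    obtain rfl := hD.injOn_rng hd hd' (h.symm.trans h')
    rfl

end BisectionOperations

/-- Convolution of complex functions on a groupoid:
`(f * g)(x)` is the sum of `f y * g (y⁻¹ x)` over all `y` with the same range as `x`
(a finite sum as soon as `f` lies in the Steinberg algebra). -/
noncomputable def conv {G : Type*} [TopologicalSpace G] [TopGroupoid G] (f g : G → ℂ) (x : G) : ℂ :=
  ∑ᶠ y : {y : G // rng y = rng x}, f y * g (mul (inv (y : G)) x)

/-- The involution `f*(x) = conj (f (x⁻¹))` on complex functions on a groupoid. -/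
noncomputable def invol {G : Type*} [TopologicalSpace G] [TopGroupoid G] (f : G → ℂ) (x : G) : ℂ :=
  star (f (inv x))

/-- The characteristic function of a set of arrows. -/
noncomputable def charFun {G : Type*} (B : Set G) : G → ℂ := B.indicator fun _ => 1

/-- The complex Steinberg algebra `A(G)`, as a space of functions: the linear span of the
characteristic functions of compact open bisections. -/
def Steinberg (G : Type*) [TopologicalSpace G] [TopGroupoid G] : Submodule ℂ (G → ℂ) :=
  Submodule.span ℂ {f | ∃ B : Set G, IsCompactOpenBisection B ∧ f = charFun B}

section Convolution

variable {G : Type*} [TopologicalSpace G] [TopGroupoid G]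

theorem charFun_mem {B : Set G} (hB : IsCompactOpenBisection B) : charFun B ∈ Steinberg G :=
  Submodule.subset_span ⟨B, hB, rfl⟩

theorem finite_fiber {f : G → ℂ} (hf : f ∈ Steinberg G) (x : G) :
    (Function.support fun y : {y : G // rng y = rng x} => f y).Finite := by
  induction hf using Submodule.span_induction with
  | mem f h =>
    obtain ⟨B, hB, rfl⟩ := h
    refine Set.Subsingleton.finite ?_
    intro y hy z hz
    have hy' : (y : G) ∈ B := by
      by_contra h
      exact hy (Set.indicator_of_notMem h _)
    have hz' : (z : G) ∈ B := by
      by_contra h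
      exact hz (Set.indicator_of_notMem h _)
    exact Subtype.ext (hB.injOn_rng hy' hz' (y.2.trans z.2.symm))
  | zero => simp [Function.support]
  | add f g _ _ hf hg =>
    refine (hf.union hg).subset ?_
    exact Function.support_add (fun y : {y : G // rng y = rng x} => f y) (fun y => g y)
  | smul a f _ hf =>
    refine hf.subset ?_
    intro y hy h
    exact hy (by simp [show f y = 0 from h])

theorem finite_term {f : G → ℂ} (hf : f ∈ Steinberg G) (g : G → ℂ) (x : G) :
    (Function.support fun y : {y : G // rng y = rng x} =>
      f y * g (mul (inv (y : G)) x)).Finite :=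
  (finite_fiber hf x).subset fun y hy h => hy (by simp [show f y = 0 from h])

theorem conv_zero_left (g : G → ℂ) : conv 0 g = 0 := by
  funext x
  simp [conv]

theorem conv_zero_right (f : G → ℂ) : conv f 0 = 0 := by
  funext x
  simp [conv]

theorem conv_add_left {f₁ f₂ : G → ℂ} (h₁ : f₁ ∈ Steinberg G) (h₂ : f₂ ∈ Steinberg G)
    (g : G → ℂ) : conv (f₁ + f₂) g = conv f₁ g + conv f₂ g := by
  funext x
  simp only [conv, Pi.add_apply, add_mul]
  exact finsum_add_distrib (finite_term h₁ g x) (finite_term h₂ g x)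

theorem conv_add_right {f : G → ℂ} (hf : f ∈ Steinberg G) (g₁ g₂ : G → ℂ) :
    conv f (g₁ + g₂) = conv f g₁ + conv f g₂ := by
  funext x
  simp only [conv, Pi.add_apply, mul_add]
  exact finsum_add_distrib (finite_term hf g₁ x) (finite_term hf g₂ x)

theorem conv_smul_left (a : ℂ) (f g : G → ℂ) : conv (a • f) g = a • conv f g := by
  funext x
  simp only [conv, Pi.smul_apply, smul_finsum, smul_mul_assoc]

theorem conv_smul_right (a : ℂ) (f g : G → ℂ) : conv f (a • g) = a • conv f g := by
  funext x
  simp only [conv, Pi.smul_apply, smul_finsum, mul_smul_comm]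

theorem conv_charFun_of_mem {B : Set G} (hB : IsCompactOpenBisection B) (g : G → ℂ) {x y : G}
    (hy : y ∈ B) (h : rng y = rng x) : conv (charFun B) g x = g (mul (inv y) x) := by
  rw [conv, finsum_eq_single _ (⟨y, h⟩ : {y : G // rng y = rng x})]
  · simp [charFun, hy]
  · intro z hz
    have : (z : G) ∉ B := fun hzB =>
      hz (Subtype.ext (hB.injOn_rng hzB hy (z.2.trans h.symm)))
    simp [charFun, this]

theorem conv_charFun_of_notMem {B : Set G} (g : G → ℂ) {x : G}
    (h : ¬ ∃ y ∈ B, rng y = rng x) : conv (charFun B) g x = 0 := by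
  rw [conv, ← finsum_zero (α := {y : G // rng y = rng x})]
  congr 1
  funext z
  have : (z : G) ∉ B := fun hzB => h ⟨z, hzB, z.2⟩
  simp [charFun, this]

/-- The defining property `1_B * 1_D = 1_{BD}` of the product of the Steinberg algebra. -/
theorem conv_charFun_charFun {B : Set G} (hB : IsCompactOpenBisection B) (D : Set G) :
    conv (charFun B) (charFun D) = charFun (setMul B D) := by
  classical
  funext x
  by_cases h : ∃ y ∈ B, rng y = rng x
  · obtain ⟨y, hy, hyx⟩ := h
    rw [conv_charFun_of_mem hB _ hy hyx]
    have : mul (inv y) x ∈ D ↔ x ∈ setMul B D := by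
      rw [mem_setMul_iff]
      constructor
      · exact fun hd => ⟨y, hy, hyx, hd⟩
      · rintro ⟨z, hz, hzx, hd⟩
        rwa [hB.injOn_rng hy hz (hyx.trans hzx.symm)]
    simp only [charFun, Set.indicator_apply, this]
  · rw [conv_charFun_of_notMem _ h]
    have : x ∉ setMul B D := by
      rw [mem_setMul_iff]
      rintro ⟨y, hy, hyx, _⟩
      exact h ⟨y, hy, hyx⟩
    simp [charFun, this]

theorem invol_charFun (B : Set G) : invol (charFun B) = charFun (setInv B) := by
  classical
  funext x
  by_cases h : inv x ∈ B
  · have h' : x ∈ setInv B := h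
    simp [invol, charFun, h, h']
  · have h' : x ∉ setInv B := h
    simp [invol, charFun, h, h']

theorem invol_add (f g : G → ℂ) : invol (f + g) = invol f + invol g := by
  funext x
  simp [invol]

theorem invol_smul (a : ℂ) (f : G → ℂ) : invol (a • f) = star a • invol f := by
  funext x
  simp [invol]

theorem invol_zero : invol (0 : G → ℂ) = 0 := by
  funext x
  simp [invol]

theorem invol_invol (f : G → ℂ) : invol (invol f) = f := by
  funext x
  simp [invol, inv_inv]

theorem invol_mem {f : G → ℂ} (hf : f ∈ Steinberg G) : invol f ∈ Steinberg G := by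
  induction hf using Submodule.span_induction with
  | mem f h =>
    obtain ⟨B, hB, rfl⟩ := h
    rw [invol_charFun]
    exact charFun_mem hB.setInv
  | zero => rw [invol_zero]; exact Submodule.zero_mem _
  | add f g _ _ hf hg => rw [invol_add]; exact Submodule.add_mem _ hf hg
  | smul a f _ hf => rw [invol_smul]; exact Submodule.smul_mem _ _ hf

theorem invol_conv {f g : G → ℂ} (hf : f ∈ Steinberg G) (hg : g ∈ Steinberg G) :
    invol (conv f g) = conv (invol g) (invol f) := by
  induction hf using Submodule.span_induction with
  | mem f h =>
    obtain ⟨B, hB, rfl⟩ := h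
    induction hg using Submodule.span_induction with
    | mem g h =>
      obtain ⟨D, hD, rfl⟩ := h
      rw [conv_charFun_charFun hB, invol_charFun, invol_charFun, invol_charFun,
        conv_charFun_charFun hD.setInv]
      congr 1
      ext z
      constructor
      · rintro ⟨b, hb, d, hd, h, hz⟩
        refine ⟨inv d, ?_, inv b, ?_, ?_, ?_⟩
        · simpa [setInv, inv_inv] using hd
        · simpa [setInv, inv_inv] using hb
        · rw [src_inv, rng_inv, h]
        · rw [← inv_mul_rev b d h, ← hz, inv_inv]
      · rintro ⟨d, hd, b, hb, h, rfl⟩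
        exact ⟨inv b, hb, inv d, hd, by rw [src_inv, rng_inv, h], inv_mul_rev d b h⟩
    | zero => rw [conv_zero_right, invol_zero, conv_zero_left]
    | add g₁ g₂ hg₁ hg₂ h₁ h₂ =>
      rw [conv_add_right (charFun_mem hB), invol_add, invol_add,
        conv_add_left (invol_mem hg₁) (invol_mem hg₂), h₁, h₂]
    | smul a g _ h => rw [conv_smul_right, invol_smul, invol_smul, conv_smul_left, h]
  | zero => rw [conv_zero_left, invol_zero, conv_zero_right]
  | add f₁ f₂ hf₁ hf₂ h₁ h₂ =>
    rw [conv_add_left hf₁ hf₂, invol_add, invol_add, conv_add_right (invol_mem hg), h₁, h₂]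
  | smul a f _ h => rw [conv_smul_left, invol_smul, invol_smul, conv_smul_right, h]

/-- The involution of the Steinberg algebra. -/
noncomputable instance : Star (Steinberg G) where
  star f := ⟨invol f, invol_mem f.2⟩

theorem Steinberg.coe_star (f : Steinberg G) : ((star f : Steinberg G) : G → ℂ) = invol f := rfl

variable [IsAmple G] [T2Space (units G)]

theorem conv_mem {f g : G → ℂ} (hf : f ∈ Steinberg G) (hg : g ∈ Steinberg G) :
    conv f g ∈ Steinberg G := by
  induction hf using Submodule.span_induction with
  | mem f h =>
    obtain ⟨B, hB, rfl⟩ := h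
    induction hg using Submodule.span_induction with
    | mem g h =>
      obtain ⟨D, hD, rfl⟩ := h
      rw [conv_charFun_charFun hB]
      exact charFun_mem (hB.setMul hD)
    | zero => rw [conv_zero_right]; exact Submodule.zero_mem _
    | add g₁ g₂ _ _ h₁ h₂ =>
      rw [conv_add_right (charFun_mem hB)]
      exact Submodule.add_mem _ h₁ h₂
    | smul a g _ h => rw [conv_smul_right]; exact Submodule.smul_mem _ _ h
  | zero => rw [conv_zero_left]; exact Submodule.zero_mem _
  | add f₁ f₂ hf₁ hf₂ h₁ h₂ =>
    rw [conv_add_left hf₁ hf₂]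
    exact Submodule.add_mem _ h₁ h₂
  | smul a f _ h => rw [conv_smul_left]; exact Submodule.smul_mem _ _ h

theorem conv_charFun_assoc {B D : Set G} (hB : IsCompactOpenBisection B)
    (hD : IsCompactOpenBisection D) (k : G → ℂ) :
    conv (conv (charFun B) (charFun D)) k = conv (charFun B) (conv (charFun D) k) := by
  rw [conv_charFun_charFun hB]
  funext x
  by_cases h : ∃ y ∈ B, rng y = rng x
  · obtain ⟨y, hy, hyx⟩ := h
    have hcomp : src (inv y) = rng x := by rw [src_inv, hyx]
    rw [conv_charFun_of_mem hB _ hy hyx]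
    by_cases h' : ∃ z ∈ D, rng z = rng (mul (inv y) x)
    · obtain ⟨z, hz, hzx⟩ := h'
      rw [conv_charFun_of_mem hD _ hz hzx]
      have hyz : src y = rng z := by rw [hzx, rng_mul _ _ hcomp, rng_inv]
      rw [conv_charFun_of_mem (hB.setMul hD) k (y := mul y z) ⟨y, hy, z, hz, hyz, rfl⟩
        (by rw [rng_mul _ _ hyz, hyx]), inv_mul_rev y z hyz,
        mul_assoc (inv z) (inv y) x (by rw [src_inv, rng_inv, hyz]) hcomp]
    · rw [conv_charFun_of_notMem _ h', conv_charFun_of_notMem]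
      rintro ⟨_, ⟨b, hb, d, hd, hbd, rfl⟩, hr⟩
      rw [rng_mul _ _ hbd] at hr
      obtain rfl := hB.injOn_rng hb hy (hr.trans hyx.symm)
      exact h' ⟨d, hd, by rw [rng_mul _ _ hcomp, rng_inv, hbd]⟩
  · rw [conv_charFun_of_notMem _ h, conv_charFun_of_notMem]
    rintro ⟨_, ⟨b, hb, d, hd, hbd, rfl⟩, hr⟩
    exact h ⟨b, hb, by rw [← hr, rng_mul _ _ hbd]⟩

theorem conv_assoc {f g : G → ℂ} (hf : f ∈ Steinberg G) (hg : g ∈ Steinberg G) (k : G → ℂ) :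
    conv (conv f g) k = conv f (conv g k) := by
  induction hf using Submodule.span_induction with
  | mem f h =>
    obtain ⟨B, hB, rfl⟩ := h
    induction hg using Submodule.span_induction with
    | mem g h =>
      obtain ⟨D, hD, rfl⟩ := h
      exact conv_charFun_assoc hB hD k
    | zero => rw [conv_zero_right, conv_zero_left, conv_zero_right]
    | add g₁ g₂ hg₁ hg₂ h₁ h₂ =>
      rw [conv_add_right (charFun_mem hB), conv_add_left (conv_mem (charFun_mem hB) hg₁)
        (conv_mem (charFun_mem hB) hg₂), conv_add_left hg₁ hg₂, conv_add_right (charFun_mem hB),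
        h₁, h₂]
    | smul a g _ h => rw [conv_smul_right, conv_smul_left, conv_smul_left, conv_smul_right, h]
  | zero => simp only [conv_zero_left]
  | add f₁ f₂ hf₁ hf₂ h₁ h₂ =>
    rw [conv_add_left hf₁ hf₂, conv_add_left (conv_mem hf₁ hg) (conv_mem hf₂ hg),
      conv_add_left hf₁ hf₂, h₁, h₂]
  | smul a f _ h => rw [conv_smul_left, conv_smul_left, conv_smul_left, h]

end Convolution

section SteinbergAlgebra

variable (G : Type*) [TopologicalSpace G] [TopGroupoid G] [IsAmple G] [T2Space (units G)]

/-- The product of the Steinberg algebra is convolution. -/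
noncomputable instance : Mul (Steinberg G) where
  mul f g := ⟨conv f g, conv_mem f.2 g.2⟩

theorem Steinberg.coe_mul (f g : Steinberg G) : ((f * g : Steinberg G) : G → ℂ) = conv f g := rfl

/-- The Steinberg algebra as a ring: pointwise addition, convolution product. -/
noncomputable instance : NonUnitalRing (Steinberg G) :=
  { (Steinberg G).addCommGroup with
    left_distrib := fun f g h => Subtype.ext (conv_add_right f.2 g h)
    right_distrib := fun f g h => Subtype.ext (conv_add_left f.2 g.2 h)
    zero_mul := fun g => Subtype.ext (conv_zero_left (g : G → ℂ))
    mul_zero := fun f => Subtype.ext (conv_zero_right (f : G → ℂ))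
    mul_assoc := fun f g h => Subtype.ext (conv_assoc f.2 g.2 h) }

end SteinbergAlgebra

/-- The Hilbert space `ℓ²(G)`, the direct sum of the spaces `ℓ²(G_u)` over all units `u`, where
`G_u` is the set of arrows with source `u`. -/
abbrev Hilb (G : Type*) : Type _ := lp (fun _ : G => ℂ) 2

section RegularRepresentation

variable {G : Type*} [TopologicalSpace G] [TopGroupoid G]

theorem sum_conv_charFun_le {B : Set G} (hB : IsCompactOpenBisection B) (ξ : Hilb G)
    (s : Finset G) :
    ∑ x ∈ s, ‖conv (charFun B) ξ x‖ ^ (2 : ENNReal).toReal ≤ ‖ξ‖ ^ (2 : ENNReal).toReal := by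
  classical
  have hp : 0 < (2 : ENNReal).toReal := by norm_num
  choose! φ hφ using fun (x : G) (h : ∃ y ∈ B, rng y = rng x) => h
  set t := s.filter fun x => ∃ y ∈ B, rng y = rng x with ht
  have hinj : Set.InjOn (fun x => mul (inv (φ x)) x) (t : Set G) := by
    intro x hx x' hx' he
    have h1 := hφ x (Finset.mem_filter.1 (Finset.mem_coe.1 hx)).2
    have h2 := hφ x' (Finset.mem_filter.1 (Finset.mem_coe.1 hx')).2
    simp only at he
    have e : φ x = φ x' := by
      apply hB.injOn_src h1.1 h2.1
      have := congrArg rng he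
      rwa [rng_mul _ _ (by rw [src_inv, h1.2]), rng_mul _ _ (by rw [src_inv, h2.2]), rng_inv,
        rng_inv] at this
    have := congrArg (mul (φ x)) he
    rwa [mul_inv_cancel_left _ _ h1.2, e, mul_inv_cancel_left _ _ h2.2] at this
  calc ∑ x ∈ s, ‖conv (charFun B) ξ x‖ ^ (2 : ENNReal).toReal
      = ∑ x ∈ t, ‖conv (charFun B) ξ x‖ ^ (2 : ENNReal).toReal := by
        refine (Finset.sum_subset (Finset.filter_subset _ _) ?_).symm
        intro x hx hxt
        rw [conv_charFun_of_notMem _ fun h => hxt (Finset.mem_filter.2 ⟨hx, h⟩)]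
        simp
    _ = ∑ x ∈ t, ‖ξ (mul (inv (φ x)) x)‖ ^ (2 : ENNReal).toReal := by
        refine Finset.sum_congr rfl fun x hx => ?_
        have h1 := hφ x (Finset.mem_filter.1 hx).2
        rw [conv_charFun_of_mem hB _ h1.1 h1.2]
    _ = ∑ z ∈ t.image (fun x => mul (inv (φ x)) x), ‖ξ z‖ ^ (2 : ENNReal).toReal :=
        (Finset.sum_image (f := fun z => ‖ξ z‖ ^ (2 : ENNReal).toReal) hinj).symm
    _ ≤ ‖ξ‖ ^ (2 : ENNReal).toReal := lp.sum_rpow_le_norm_rpow hp ξ _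

theorem memℓp_conv {f : G → ℂ} (hf : f ∈ Steinberg G) (ξ : Hilb G) : Memℓp (conv f ξ) 2 := by
  induction hf using Submodule.span_induction with
  | mem f h =>
    obtain ⟨B, hB, rfl⟩ := h
    exact memℓp_gen' (sum_conv_charFun_le hB ξ)
  | zero => rw [conv_zero_left]; exact zero_memℓp
  | add f g hf hg h₁ h₂ => rw [conv_add_left hf hg]; exact h₁.add h₂
  | smul a f _ h => rw [conv_smul_left]; exact h.const_smul a

/-- The linear map `ξ ↦ f * ξ` on `ℓ²(G)`, for `f` in the Steinberg algebra. -/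
noncomputable def convLinear (f : Steinberg G) : Hilb G →ₗ[ℂ] Hilb G where
  toFun ξ := ⟨conv f ξ, memℓp_conv f.2 ξ⟩
  map_add' ξ η := Subtype.ext (conv_add_right f.2 ξ η)
  map_smul' a ξ := Subtype.ext (conv_smul_right a f ξ)

theorem convLinear_bound (f : Steinberg G) : ∃ C : ℝ, ∀ ξ : Hilb G, ‖convLinear f ξ‖ ≤ C * ‖ξ‖ := by
  obtain ⟨f, hf⟩ := f
  induction hf using Submodule.span_induction with
  | mem f h =>
    obtain ⟨B, hB, rfl⟩ := h
    refine ⟨1, fun ξ => ?_⟩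
    rw [one_mul]
    exact lp.norm_le_of_forall_sum_le (by norm_num) (norm_nonneg _) (sum_conv_charFun_le hB ξ)
  | zero =>
    refine ⟨0, fun ξ => ?_⟩
    have : convLinear (⟨0, Submodule.zero_mem _⟩ : Steinberg G) ξ = 0 :=
      Subtype.ext (conv_zero_left (ξ : G → ℂ))
    simp [this]
  | add f g hf hg h₁ h₂ =>
    obtain ⟨C₁, h₁⟩ := h₁
    obtain ⟨C₂, h₂⟩ := h₂
    refine ⟨C₁ + C₂, fun ξ => ?_⟩
    have : convLinear (⟨f + g, Submodule.add_mem _ hf hg⟩ : Steinberg G) ξ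
        = convLinear ⟨f, hf⟩ ξ + convLinear ⟨g, hg⟩ ξ :=
      Subtype.ext (conv_add_left hf hg ξ)
    rw [this, add_mul]
    exact (norm_add_le _ _).trans (add_le_add (h₁ ξ) (h₂ ξ))
  | smul a f hf h =>
    obtain ⟨C, h⟩ := h
    refine ⟨‖a‖ * C, fun ξ => ?_⟩
    have : convLinear (⟨a • f, Submodule.smul_mem _ a hf⟩ : Steinberg G) ξ
        = a • convLinear ⟨f, hf⟩ ξ :=
      Subtype.ext (conv_smul_left a f ξ)
    rw [this, norm_smul, _root_.mul_assoc]
    exact mul_le_mul_of_nonneg_left (h ξ) (norm_nonneg a)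

/-- The bounded operator `ξ ↦ f * ξ` on `ℓ²(G)`, for `f` in the Steinberg algebra.  It is the
direct sum over all units `u` of the left regular representations of `f` on `ℓ²(G_u)`. -/
noncomputable def regOp (f : Steinberg G) : Hilb G →L[ℂ] Hilb G :=
  (convLinear f).mkContinuousOfExistsBound (convLinear_bound f)

theorem coe_regOp (f : Steinberg G) (ξ : Hilb G) :
    ((regOp f ξ : Hilb G) : G → ℂ) = conv f ξ := rfl

theorem regOp_zero : regOp (0 : Steinberg G) = 0 :=
  ContinuousLinearMap.ext fun ξ => Subtype.ext (conv_zero_left (ξ : G → ℂ))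

theorem regOp_add (f g : Steinberg G) : regOp (f + g) = regOp f + regOp g :=
  ContinuousLinearMap.ext fun ξ => Subtype.ext (conv_add_left f.2 g.2 (ξ : G → ℂ))

theorem regOp_smul (a : ℂ) (f : Steinberg G) : regOp (a • f) = a • regOp f :=
  ContinuousLinearMap.ext fun ξ => Subtype.ext (conv_smul_left a (f : G → ℂ) (ξ : G → ℂ))

theorem inner_conv_charFun {B : Set G} (hB : IsCompactOpenBisection B) (ξ η : Hilb G) :
    inner ℂ (regOp ⟨charFun B, charFun_mem hB⟩ ξ) η
      = inner ℂ ξ (regOp ⟨charFun (setInv B), charFun_mem hB.setInv⟩ η) := by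
  classical
  rw [lp.inner_eq_tsum, lp.inner_eq_tsum]
  simp only [coe_regOp]
  have key : ∀ z : G, inner ℂ (ξ z) (conv (charFun (setInv B)) η z) ≠ 0 →
      ∃ y ∈ B, src y = rng z := by
    intro z hz
    by_contra h
    apply hz
    rw [conv_charFun_of_notMem, inner_zero_right]
    rintro ⟨y, hy, hr⟩
    exact h ⟨inv y, hy, by rw [src_inv, hr]⟩
  choose! φ hφ using fun (z : G) (h : ∃ y ∈ B, src y = rng z) => h
  refine tsum_eq_tsum_of_ne_zero_bij (fun z => mul (φ z) z) ?_ ?_ ?_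
  · rintro ⟨z, hz⟩ ⟨z', hz'⟩ he
    have h1 := hφ z (key z hz)
    have h2 := hφ z' (key z' hz')
    simp only at he
    have e : φ z = φ z' := by
      apply hB.injOn_rng h1.1 h2.1
      have := congrArg rng he
      rwa [rng_mul _ _ h1.2, rng_mul _ _ h2.2] at this
    have := congrArg (mul (inv (φ z))) he
    rw [inv_mul_cancel_left _ _ h1.2, e, inv_mul_cancel_left _ _ h2.2] at this
    exact Subtype.ext this
  · intro x hx
    have hx' : ∃ y ∈ B, rng y = rng x := by
      by_contra h
      exact hx (by simp only [conv_charFun_of_notMem _ h, inner_zero_left])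
    obtain ⟨y, hy, hyx⟩ := hx'
    have hc : src (inv y) = rng x := by rw [src_inv, hyx]
    have hr : src y = rng (mul (inv y) x) := by rw [rng_mul _ _ hc, rng_inv]
    have hφ' := hφ (mul (inv y) x) ⟨y, hy, hr⟩
    have e : φ (mul (inv y) x) = y := hB.injOn_src hφ'.1 hy (hφ'.2.trans hr.symm)
    refine ⟨⟨mul (inv y) x, ?_⟩, ?_⟩
    · rw [Function.mem_support] at hx ⊢
      rw [conv_charFun_of_mem hB _ hy hyx] at hx
      rwa [conv_charFun_of_mem hB.setInv _ (y := inv y)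
        (by simpa [setInv, inv_inv] using hy) (by rw [rng_inv, hr]), inv_inv,
        mul_inv_cancel_left _ _ hyx]
    · simp only [e]
      exact mul_inv_cancel_left _ _ hyx
  · rintro ⟨z, hz⟩
    have h1 := hφ z (key z hz)
    simp only
    rw [conv_charFun_of_mem hB _ h1.1 (rng_mul _ _ h1.2).symm, inv_mul_cancel_left _ _ h1.2,
      conv_charFun_of_mem hB.setInv _ (y := inv (φ z))
        (by simpa [setInv, inv_inv] using h1.1) (by rw [rng_inv, h1.2]), inv_inv]

theorem inner_regOp {f : G → ℂ} (hf : f ∈ Steinberg G) (ξ η : Hilb G) :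
    inner ℂ (regOp ⟨f, hf⟩ ξ) η = inner ℂ ξ (regOp ⟨invol f, invol_mem hf⟩ η) := by
  induction hf using Submodule.span_induction with
  | mem f h =>
    obtain ⟨B, hB, rfl⟩ := h
    have := inner_conv_charFun hB ξ η
    simpa only [invol_charFun] using this
  | zero =>
    have e1 : regOp (⟨0, Submodule.zero_mem _⟩ : Steinberg G) ξ = 0 :=
      Subtype.ext (conv_zero_left (ξ : G → ℂ))
    have e2 : regOp (⟨invol 0, invol_mem (Submodule.zero_mem _)⟩ : Steinberg G) η = 0 := by
      refine Subtype.ext ?_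
      rw [coe_regOp]
      simp only [invol_zero, conv_zero_left]
      rfl
    exact (congrArg (inner ℂ · η) e1).trans
      (((inner_zero_left η).trans (inner_zero_right ξ).symm).trans
        (congrArg (inner ℂ ξ ·) e2.symm))
  | add f g hf hg h₁ h₂ =>
    have e1 : regOp (⟨f + g, Submodule.add_mem _ hf hg⟩ : Steinberg G) ξ
        = regOp ⟨f, hf⟩ ξ + regOp ⟨g, hg⟩ ξ := Subtype.ext (conv_add_left hf hg (ξ : G → ℂ))
    have e2 : regOp (⟨invol (f + g), invol_mem (Submodule.add_mem _ hf hg)⟩ : Steinberg G) η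
        = regOp ⟨invol f, invol_mem hf⟩ η + regOp ⟨invol g, invol_mem hg⟩ η := by
      refine Subtype.ext ?_
      rw [coe_regOp]
      simp only [invol_add]
      exact conv_add_left (invol_mem hf) (invol_mem hg) (η : G → ℂ)
    refine (congrArg (inner ℂ · η) e1).trans (Eq.trans ?_ (congrArg (inner ℂ ξ ·) e2.symm))
    simp only [inner_add_left, inner_add_right, h₁, h₂]
  | smul a f hf h =>
    have e1 : regOp (⟨a • f, Submodule.smul_mem _ a hf⟩ : Steinberg G) ξ
        = a • regOp ⟨f, hf⟩ ξ := Subtype.ext (conv_smul_left a f (ξ : G → ℂ))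
    have e2 : regOp (⟨invol (a • f), invol_mem (Submodule.smul_mem _ a hf)⟩ : Steinberg G) η
        = star a • regOp ⟨invol f, invol_mem hf⟩ η := by
      refine Subtype.ext ?_
      rw [coe_regOp]
      simp only [invol_smul]
      exact conv_smul_left (star a) (invol f) (η : G → ℂ)
    refine (congrArg (inner ℂ · η) e1).trans (Eq.trans ?_ (congrArg (inner ℂ ξ ·) e2.symm))
    simp only [inner_smul_left, inner_smul_right, h]
    rfl

end RegularRepresentation

section ReducedAlgebra

variable (G : Type*) [TopologicalSpace G] [TopGroupoid G] [IsAmple G] [T2Space (units G)]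

/-- The left regular representation of the Steinberg algebra on `ℓ²(G)`. -/
noncomputable def regRep : Steinberg G →⋆ₙₐ[ℂ] (Hilb G →L[ℂ] Hilb G) where
  toFun := regOp
  map_smul' := regOp_smul
  map_zero' := regOp_zero
  map_add' := regOp_add
  map_mul' f g := ContinuousLinearMap.ext fun ξ =>
    Subtype.ext (conv_assoc f.2 g.2 (ξ : G → ℂ))
  map_star' f := by
    rw [ContinuousLinearMap.star_eq_adjoint, ContinuousLinearMap.eq_adjoint_iff]
    intro ξ η
    have h : (⟨invol ((star f : Steinberg G) : G → ℂ), invol_mem (star f : Steinberg G).2⟩ :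
        Steinberg G) = f := Subtype.ext (invol_invol (f : G → ℂ))
    exact (inner_regOp (star f : Steinberg G).2 ξ η).trans
      (congrArg (fun k : Steinberg G => inner ℂ ξ (regOp k η)) h)

/-- The reduced C*-algebra `C*_r(G)`: the norm closure of the image of the Steinberg algebra under
the left regular representation, i.e. the completion of `A(G)` in the reduced norm. -/
noncomputable def ReducedCStar : NonUnitalStarSubalgebra ℂ (Hilb G →L[ℂ] Hilb G) :=
  (NonUnitalStarAlgHom.range (regRep G)).topologicalClosure

instance : IsClosed ((ReducedCStar G : NonUnitalStarSubalgebra ℂ (Hilb G →L[ℂ] Hilb G)) :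
    Set (Hilb G →L[ℂ] Hilb G)) :=
  NonUnitalStarSubalgebra.isClosed_topologicalClosure _

noncomputable instance : NonUnitalCStarAlgebra (ReducedCStar G) :=
  NonUnitalStarSubalgebra.nonUnitalCStarAlgebra (ReducedCStar G)

/-- The canonical linear map of the Steinberg algebra into the reduced C*-algebra. -/
noncomputable def toReduced : Steinberg G →ₗ[ℂ] ReducedCStar G where
  toFun f := ⟨regRep G f, NonUnitalStarSubalgebra.le_topologicalClosure _ ⟨f, rfl⟩⟩
  map_add' f g := Subtype.ext (map_add (regRep G) f g)
  map_smul' a f := Subtype.ext (map_smul (regRep G) a f)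

end ReducedAlgebra

/-- A continuous cocycle from a topological groupoid to a group with a topology. -/
structure IsContinuousCocycle {G Γ : Type*} [TopologicalSpace G] [TopGroupoid G] [Group Γ]
    [TopologicalSpace Γ] (c : G → Γ) : Prop where
  continuous : Continuous c
  map_mul : ∀ x y : G, src x = rng y → c (mul x y) = c x * c y

/-- The groupoid `G` is strongly graded by `c`: `G_α G_β = G_{αβ}`, where `G_γ = c⁻¹(γ)`. -/
def IsStronglyGradedGroupoid {G Γ : Type*} [TopologicalSpace G] [TopGroupoid G] [Group Γ]
    (c : G → Γ) : Prop :=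
  ∀ α β : Γ, setMul (c ⁻¹' {α}) (c ⁻¹' {β}) = c ⁻¹' {α * β}

/-- The homogeneous component `A(G)_γ`: the elements of `A(G)` vanishing off `G_γ`. -/
def steinbergComponent {G Γ : Type*} [TopologicalSpace G] [TopGroupoid G] (c : G → Γ) (γ : Γ) :
    Submodule ℂ (Steinberg G) where
  carrier := {f | Function.support (f : G → ℂ) ⊆ c ⁻¹' {γ}}
  add_mem' {f g} hf hg := (Function.support_add (f : G → ℂ) (g : G → ℂ)).trans
    (Set.union_subset hf hg)
  zero_mem' := by simp [Function.support]
  smul_mem' a f hf := (Function.support_const_smul_subset a (f : G → ℂ)).trans hf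

/-- The component `C*_r(G)_γ`: the closure of `A(G)_γ` in `C*_r(G)`. -/
noncomputable def reducedComponent {G Γ : Type*} [TopologicalSpace G] [TopGroupoid G] [IsAmple G]
    [T2Space (units G)] (c : G → Γ) (γ : Γ) : Submodule ℂ (ReducedCStar G) :=
  ((steinbergComponent c γ).map (toReduced G)).topologicalClosure

end TopGroupoid

/-- The subgroup of all finite sums of products `a * b` with `a ∈ S` and `b ∈ T`. -/
def productSubgroup {R : Type*} [NonUnitalRing R] (S T : AddSubgroup R) : AddSubgroup R :=
  AddSubgroup.closure {z | ∃ a ∈ S, ∃ b ∈ T, z = a * b}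

open Classical in
/-- The ring `R` is `Γ`-graded by the family `𝒜` of additive subgroups. -/
structure IsGradedRing {R Γ : Type*} [NonUnitalRing R] [Group Γ] (𝒜 : Γ → AddSubgroup R) :
    Prop where
  mul_le : ∀ α β : Γ, productSubgroup (𝒜 α) (𝒜 β) ≤ 𝒜 (α * β)
  isInternal : DirectSum.IsInternal 𝒜

/-- The ring `R` is strongly `Γ`-graded by the family `𝒜` of additive subgroups. -/
structure IsStronglyGradedRing {R Γ : Type*} [NonUnitalRing R] [Group Γ]
    (𝒜 : Γ → AddSubgroup R) : Prop extends IsGradedRing 𝒜 where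
  mul_eq : ∀ α β : Γ, productSubgroup (𝒜 α) (𝒜 β) = 𝒜 (α * β)

/-- The linear span of all products `a * b` with `a ∈ S` and `b ∈ T`. -/
def productSpan {A : Type*} [NonUnitalCStarAlgebra A] (S T : Submodule ℂ A) : Submodule ℂ A :=
  Submodule.span ℂ {z | ∃ a ∈ S, ∃ b ∈ T, z = a * b}

/-- The C*-algebra `A` is `Γ`-graded by the family `𝒜` of subspaces. -/
structure IsGradedCStarAlgebra {A Γ : Type*} [NonUnitalCStarAlgebra A] [Group Γ]
    (𝒜 : Γ → Submodule ℂ A) : Prop where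
  isClosed : ∀ γ : Γ, IsClosed (𝒜 γ : Set A)
  linearIndependent : iSupIndep 𝒜
  mul_le : ∀ α β : Γ, productSpan (𝒜 α) (𝒜 β) ≤ 𝒜 (α * β)
  star_mem : ∀ (γ : Γ), ∀ a ∈ 𝒜 γ, star a ∈ 𝒜 γ⁻¹
  dense : Dense ((⨆ γ, 𝒜 γ : Submodule ℂ A) : Set A)

/-- The C*-algebra `A` is strongly `Γ`-graded by the family `𝒜` of subspaces: in addition to being
a grading, the span of the products of elements of `𝒜 α` and `𝒜 β` is dense in `𝒜 (α * β)`. -/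
structure IsStronglyGradedCStarAlgebra {A Γ : Type*} [NonUnitalCStarAlgebra A] [Group Γ]
    (𝒜 : Γ → Submodule ℂ A) : Prop extends IsGradedCStarAlgebra 𝒜 where
  subset_closure : ∀ α β : Γ, (𝒜 (α * β) : Set A) ⊆ closure (productSpan (𝒜 α) (𝒜 β) : Set A)

namespace TopGroupoid

/-! The hinge is a fibrewise criterion: `G` is strongly graded if and only if every `G_α` contains
an arrow with range `r(x)`, for every arrow `x`
(`IsContinuousCocycle.isStronglyGradedGroupoid_iff`). The implications then run in a cycle.

From `G` to `A(G)`: the component `A(G)_{αβ}` is spanned by functions `1_B` with `B ⊆ G_{αβ}`. Near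
a point of `B` the criterion gives a compact open bisection `D ⊆ G_α` whose ranges cover a piece `C`
of `B`; then `C = D(D⁻¹C)`, so `1_C = 1_D * 1_{D⁻¹C}` with `D⁻¹C ⊆ G_β`. Compactness and clopen
cutting reassemble `1_B` from finitely many disjoint pieces (`steinbergComponent_mul_le`,
`charFun_mem_of_isCompact`).

From `A(G)` to `C*_r(G)`: the components of `C*_r(G)` are closures of those of `A(G)`, so the
product identity passes to a density statement. Independence after closure needs an argument: the
matrix coefficient of an operator at `(x, z)` has degree `c(x)c(z)⁻¹`, and these coefficients are
continuous and separate operators (`eq_mul_of_reducedEval_single_ne_zero`,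
`eq_zero_of_reducedEval`).

From `C*_r(G)` to `G`: if `G_α` has no arrow with range `u = r(x)`, then row `u` of every operator
of degree `α` vanishes, hence so does row `u` of everything in the closed span of products of
degrees `α` and `α⁻¹`. But `1_B`, for a bisection `B` of degree `1` around `u`, has coefficient `1`
at `(u, u)` (`exists_rng_of_isStronglyGradedCStarAlgebra`). -/

theorem rng_rng {G : Type*} [TopologicalSpace G] [TopGroupoid G] (x : G) :
    rng (rng x) = rng x := by
  rw [← src_inv x, rng_src]

/-! ### Cocycles and the fibrewise criterion for strong grading. -/

section Cocycle

variable {G Γ : Type*} [TopologicalSpace G] [TopGroupoid G] [Group Γ] [TopologicalSpace Γ]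
  {c : G → Γ}

theorem IsContinuousCocycle.map_rng (hc : IsContinuousCocycle c) (x : G) : c (rng x) = 1 := by
  have h := hc.map_mul (rng x) x (src_rng x)
  rw [rng_self_mul] at h
  exact mul_eq_right.1 h.symm

theorem IsContinuousCocycle.map_inv (hc : IsContinuousCocycle c) (x : G) :
    c (inv x) = (c x)⁻¹ := by
  have h := hc.map_mul x (inv x) (rng_inv x).symm
  rw [mul_inv, hc.map_rng] at h
  exact eq_inv_of_mul_eq_one_right h.symm

theorem IsContinuousCocycle.isClopen_preimage [DiscreteTopology Γ] (hc : IsContinuousCocycle c)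
    (γ : Γ) : IsClopen (c ⁻¹' {γ}) :=
  (isClopen_discrete {γ}).preimage hc.continuous

/-- A groupoid is strongly graded if and only if each homogeneous part meets each range fibre. -/
theorem IsContinuousCocycle.isStronglyGradedGroupoid_iff (hc : IsContinuousCocycle c) :
    IsStronglyGradedGroupoid c ↔ ∀ (α : Γ) (x : G), ∃ y, c y = α ∧ rng y = rng x := by
  constructor
  · intro h α x
    -- The unit `r(x)` has degree `1 = αα⁻¹`; the left factor of its factorisation has range `r(x)`.
    have hx : rng x ∈ setMul (c ⁻¹' {α}) (c ⁻¹' {α⁻¹}) := by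
      rw [h, Set.mem_preimage, mul_inv_cancel, hc.map_rng]
      rfl
    obtain ⟨y, hy, z, -, hyz, he⟩ := hx
    refine ⟨y, hy, ?_⟩
    rw [← rng_mul y z hyz, ← he, rng_rng]
  · intro h α β
    ext x
    constructor
    · rintro ⟨y, hy, z, hz, hyz, rfl⟩
      simp only [Set.mem_preimage, Set.mem_singleton_iff] at hy hz ⊢
      rw [hc.map_mul y z hyz, hy, hz]
    · intro hx
      -- The factorisation is `x = y(y⁻¹x)`, and `y⁻¹x` has degree `α⁻¹(αβ) = β`.
      obtain ⟨y, hy, hyx⟩ := h α x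
      refine mem_setMul_iff.2 ⟨y, hy, hyx, ?_⟩
      simp only [Set.mem_preimage, Set.mem_singleton_iff] at hx ⊢
      rw [hc.map_mul _ _ (by rw [src_inv, hyx]), hc.map_inv, hy, hx, _root_.inv_mul_cancel_left]

end Cocycle

/-! ### Cutting characteristic functions along clopen sets. -/

section CharacteristicFunctions

variable {G : Type*} [TopologicalSpace G] [TopGroupoid G]

/-- Since `G` may fail to be Hausdorff, compact open sets need not be closed and two of them may
meet in a non-compact set; intersecting with a clopen set is always safe. -/
theorem IsCompactOpenBisection.inter_isClopen {B S : Set G} (hB : IsCompactOpenBisection B)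
    (hS : IsClopen S) : IsCompactOpenBisection (B ∩ S) where
  isCompact := hB.isCompact.inter_right hS.isClosed
  isOpen := hB.isOpen.inter hS.isOpen
  injOn_src := hB.injOn_src.mono Set.inter_subset_left
  injOn_rng := hB.injOn_rng.mono Set.inter_subset_left

/-- Closedness uses only that the unit space is Hausdorff: the set is the preimage under the range
map of `r(D)`, a compact and therefore closed set of units. Here `srcUnit (inv x)` is `r(x)` as a
point of the unit space. -/
theorem isClopen_rng_saturation [IsAmple G] [T2Space (units G)] {D : Set G}
    (hD : IsCompactOpenBisection D) : IsClopen {x : G | ∃ y ∈ D, rng y = rng x} := by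
  refine ⟨?_, isOpen_rng_saturation hD.isOpen⟩
  have hcont : Continuous (fun x : G => srcUnit (inv x)) :=
    (continuous_src.comp continuous_inv).subtype_mk _
  have h : {x : G | ∃ y ∈ D, rng y = rng x}
      = (fun x : G => srcUnit (inv x)) ⁻¹' ((fun x : G => srcUnit (inv x)) '' D) := by
    ext x
    simp only [Set.mem_ofPred_eq, Set.mem_preimage, Set.mem_image, srcUnit, Subtype.mk.injEq,
      src_inv]
  rw [h]
  exact (hD.isCompact.image hcont).isClosed.preimage hcont

theorem charFun_union {X : Type*} {S T : Set X} (h : Disjoint S T) :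
    (charFun (S ∪ T) : X → ℂ) = charFun S + charFun T :=
  Set.indicator_union_of_disjoint h _

theorem indicator_charFun {X : Type*} (S B : Set X) :
    S.indicator (charFun B) = charFun (B ∩ S) := by
  rw [charFun, charFun, Set.indicator_indicator, Set.inter_comm]

/-- Membership of a characteristic function in a subgroup can be checked locally on compact sets,
with respect to clopen sets. -/
theorem charFun_mem_of_isCompact {G : Type*} [TopologicalSpace G] {B : Set G}
    (hB : IsCompact B) (N : AddSubgroup (G → ℂ))
    (h : ∀ x ∈ B, ∃ S, IsClopen S ∧ x ∈ S ∧ ∀ T, IsClopen T → charFun (B ∩ (S ∩ T)) ∈ N) :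
    charFun B ∈ N := by
  -- Quantifying over all clopen `T` makes the property pass to unions: `S ∪ S'` is split into the
  -- disjoint pieces `S` and `S' \ S`, and the second is handled by the choice `T \ S` for `S'`.
  have key : ∃ S, IsClopen S ∧ B ⊆ S ∧ ∀ T, IsClopen T → charFun (B ∩ (S ∩ T)) ∈ N := by
    refine hB.induction_on
      (p := fun K => ∃ S, IsClopen S ∧ K ⊆ S ∧ ∀ T, IsClopen T → charFun (B ∩ (S ∩ T)) ∈ N)
      ⟨∅, isClopen_empty, subset_rfl, fun T _ => ?_⟩ ?_ ?_ ?_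
    · have : (charFun (B ∩ (∅ ∩ T)) : G → ℂ) = 0 := by simp [charFun]; rfl
      rw [this]
      exact N.zero_mem
    · rintro K L hKL ⟨S, hS, hLS, hN⟩
      exact ⟨S, hS, hKL.trans hLS, hN⟩
    · rintro K L ⟨S, hS, hKS, hN⟩ ⟨S', hS', hLS', hN'⟩
      refine ⟨S ∪ S', hS.union hS', Set.union_subset_union hKS hLS', fun T hT => ?_⟩
      have e : B ∩ ((S ∪ S') ∩ T) = B ∩ (S ∩ T) ∪ B ∩ (S' ∩ (T \ S)) := by
        ext x
        simp only [Set.mem_inter_iff, Set.mem_union, Set.mem_sdiff]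
        tauto
      rw [e, charFun_union (Set.disjoint_left.2 fun x hx hx' => hx'.2.2.2 hx.2.1)]
      exact N.add_mem (hN T hT) (hN' _ (hT.diff hS))
    · intro x hx
      obtain ⟨S, hS, hxS, hN⟩ := h x hx
      exact ⟨S, mem_nhdsWithin_of_mem_nhds (hS.isOpen.mem_nhds hxS), S, hS, subset_rfl, hN⟩
  obtain ⟨S, -, hBS, hN⟩ := key
  have := hN Set.univ isClopen_univ
  rwa [Set.inter_univ, Set.inter_eq_left.2 hBS] at this

/-- Restriction to `S` is linear and sends a generator `1_B` to `1_{B ∩ S}`. -/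
theorem indicator_mem_of_charFun_mem {f : G → ℂ} (hf : f ∈ Steinberg G) {S : Set G}
    (hS : IsClopen S) (N : Submodule ℂ (G → ℂ))
    (h : ∀ B, IsCompactOpenBisection B → B ⊆ S → charFun B ∈ N) : S.indicator f ∈ N := by
  induction hf using Submodule.span_induction with
  | mem f hf =>
    obtain ⟨B, hB, rfl⟩ := hf
    rw [indicator_charFun]
    exact h _ (hB.inter_isClopen hS) Set.inter_subset_right
  | zero => rw [Set.indicator_zero']; exact N.zero_mem
  | add f g _ _ hf hg => rw [Set.indicator_add']; exact N.add_mem hf hg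
  | smul a f _ hf =>
    have : S.indicator (a • f) = a • S.indicator f := Set.indicator_const_smul S a f
    rw [this]
    exact N.smul_mem a hf

theorem exists_of_conv_ne_zero {f g : G → ℂ} {x : G} (h : conv f g x ≠ 0) :
    ∃ y, rng y = rng x ∧ f y ≠ 0 ∧ g (mul (inv y) x) ≠ 0 := by
  obtain ⟨y, hy⟩ : ∃ y : {y : G // rng y = rng x}, f y * g (mul (inv (y : G)) x) ≠ 0 := by
    by_contra! h0
    exact h ((finsum_congr h0).trans finsum_zero)
  exact ⟨y, y.2, left_ne_zero_of_mul hy, right_ne_zero_of_mul hy⟩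

end CharacteristicFunctions

/-! ### Independence and multiplicativity of the homogeneous components. -/

/-- A family of subspaces is independent if there is a separating family of functionals each of
which is nonzero on at most one member of the family of subspaces. -/
theorem iSupIndep_of_functionals {ι X V : Type*} [AddCommGroup V] [Module ℂ V]
    {A : ι → Submodule ℂ V} (φ : X → V →ₗ[ℂ] ℂ) (d : X → ι)
    (h : ∀ i, ∀ v ∈ A i, ∀ x, φ x v ≠ 0 → d x = i) (h0 : ∀ v, (∀ x, φ x v = 0) → v = 0) :
    iSupIndep A := by
  intro i
  rw [Submodule.disjoint_def]
  intro v hv hv'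
  refine h0 v fun x => ?_
  by_contra hx
  obtain rfl := h i v hv x hx
  -- The functional `φ x` kills every `A j` with `j ≠ d x`, hence their supremum, which contains
  -- `v`.
  refine hx (show v ∈ (φ x).ker from ?_)
  refine (iSup₂_le fun j hj w hw => ?_ : ⨆ j, ⨆ _ : j ≠ d x, A j ≤ (φ x).ker) hv'
  by_contra hw'
  exact hj (h j w hw x hw').symm

theorem iSupIndep_steinbergComponent {G Γ : Type*} [TopologicalSpace G] [TopGroupoid G]
    (c : G → Γ) : iSupIndep (steinbergComponent c) :=
  iSupIndep_of_functionals (fun x => LinearMap.proj x ∘ₗ (Steinberg G).subtype) c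
    (fun _ f hf x (hx : (f : G → ℂ) x ≠ 0) => hf hx) fun _ hf => Subtype.ext (funext hf)

theorem charFun_mem_steinbergComponent {G Γ : Type*} [TopologicalSpace G] [TopGroupoid G]
    {c : G → Γ} {B : Set G} (hB : IsCompactOpenBisection B) {γ : Γ}
    (h : B ⊆ c ⁻¹' {γ}) :
    (⟨charFun B, charFun_mem hB⟩ : Steinberg G) ∈ steinbergComponent c γ := by
  intro x hx
  by_contra hxB
  exact hx (Set.indicator_of_notMem (s := B) (f := fun _ => (1 : ℂ)) fun h' => hxB (h h'))

theorem productSubgroup_steinbergComponent_le {G Γ : Type*} [TopologicalSpace G]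
    [TopGroupoid G] [IsAmple G] [T2Space (units G)] [Group Γ] [TopologicalSpace Γ] {c : G → Γ}
    (hc : IsContinuousCocycle c) (α β : Γ) :
    productSubgroup (steinbergComponent c α).toAddSubgroup (steinbergComponent c β).toAddSubgroup
      ≤ (steinbergComponent c (α * β)).toAddSubgroup := by
  refine (AddSubgroup.closure_le _).2 ?_
  rintro _ ⟨f, hf, g, hg, rfl⟩ x hx
  obtain ⟨y, hyx, hfy, hgy⟩ := exists_of_conv_ne_zero hx
  have h1 : c y = α := hf hfy
  have h2 : c (mul (inv y) x) = β := hg hgy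
  rw [hc.map_mul _ _ (by rw [src_inv, hyx]), hc.map_inv, h1] at h2
  rw [← h2]
  simp

/-! ### The grading of the Steinberg algebra. -/

section SteinbergGrading

variable {G Γ : Type*} [TopologicalSpace G] [TopGroupoid G] [Group Γ] [TopologicalSpace Γ]
  [DiscreteTopology Γ] {c : G → Γ}

/-- An element of `A(G)_γ` equals its own restriction to the clopen set `G_γ`, so it is a
combination of functions `1_B` with `B ⊆ G_γ`. This reduces statements about a component to
homogeneous bisections. -/
theorem steinbergComponent_le (hc : IsContinuousCocycle c) {γ : Γ} (N : Submodule ℂ (Steinberg G))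
    (h : ∀ (B : Set G) (hB : IsCompactOpenBisection B), B ⊆ c ⁻¹' {γ} →
      (⟨charFun B, charFun_mem hB⟩ : Steinberg G) ∈ N) : steinbergComponent c γ ≤ N := by
  intro f hf
  have hf' : (c ⁻¹' {γ}).indicator (f : G → ℂ) = f := Set.indicator_eq_self.2 hf
  obtain ⟨g, hg, hgf⟩ := indicator_mem_of_charFun_mem f.2 (hc.isClopen_preimage γ)
    (N.map (Steinberg G).subtype) fun B hB hBS => ⟨_, h B hB hBS, rfl⟩
  rwa [← show g = f from Subtype.ext (hgf.trans hf')]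

theorem iSup_steinbergComponent (hc : IsContinuousCocycle c) :
    ⨆ γ, steinbergComponent c γ = ⊤ := by
  set N : AddSubgroup (G → ℂ) :=
    ((⨆ γ, steinbergComponent c γ).map (Steinberg G).subtype).toAddSubgroup with hN
  have key : ∀ f ∈ Steinberg G, f ∈ (⨆ γ, steinbergComponent c γ).map (Steinberg G).subtype := by
    intro f hf
    refine Submodule.span_le.2 ?_ hf
    rintro _ ⟨B, hB, rfl⟩
    -- The clopen set around `x` is its whole degree class; cutting further by `T` keeps the piece
    -- homogeneous.
    refine charFun_mem_of_isCompact hB.isCompact N fun x _ => ⟨c ⁻¹' {c x},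
      hc.isClopen_preimage _, rfl, fun T hT => ⟨_, Submodule.mem_iSup_of_mem (c x)
        (charFun_mem_steinbergComponent
          (hB.inter_isClopen ((hc.isClopen_preimage _).inter hT)) fun y hy => hy.2.1), rfl⟩⟩
  refine eq_top_iff.2 fun f _ => ?_
  obtain ⟨g, hg, hgf⟩ := key f f.2
  rwa [← show g = f from Subtype.ext hgf]

theorem exists_isCompactOpenBisection_subset [IsAmple G] (hc : IsContinuousCocycle c) (x : G) :
    ∃ B, IsCompactOpenBisection B ∧ x ∈ B ∧ B ⊆ c ⁻¹' {c x} :=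
  IsAmple.isTopologicalBasis.exists_subset_of_mem_open rfl (hc.isClopen_preimage (c x)).isOpen

variable [IsAmple G] [T2Space (units G)]

theorem isGradedRing_steinbergComponent (hc : IsContinuousCocycle c) :
    IsGradedRing fun γ => (steinbergComponent c γ).toAddSubgroup where
  mul_le := productSubgroup_steinbergComponent_le hc
  isInternal := by
    classical
    exact (DirectSum.isInternal_submodule_iff_iSupIndep_and_iSup_eq_top _).2
      ⟨iSupIndep_steinbergComponent c, iSup_steinbergComponent hc⟩

/-- The subgroup of sums of products of elements of two homogeneous components, as a subspace. -/
noncomputable def productSubmodule (c : G → Γ) (α β : Γ) : Submodule ℂ (Steinberg G) where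
  __ := productSubgroup (steinbergComponent c α).toAddSubgroup
    (steinbergComponent c β).toAddSubgroup
  smul_mem' a f hf := by
    induction hf using AddSubgroup.closure_induction with
    | mem f hf =>
      obtain ⟨g, hg, k, hk, rfl⟩ := hf
      exact AddSubgroup.subset_closure ⟨a • g, Submodule.smul_mem _ a hg, k, hk,
        Subtype.ext (conv_smul_left a (g : G → ℂ) k).symm⟩
    | zero => rw [smul_zero]; exact AddSubgroup.zero_mem _
    | add f g _ _ hf hg => rw [smul_add]; exact AddSubgroup.add_mem _ hf hg
    | neg f _ hf => rw [smul_neg]; exact AddSubgroup.neg_mem _ hf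

/-- Locally `1_C = 1_D * 1_{D⁻¹C}` with `D ⊆ G_α` and `D⁻¹C ⊆ G_β`, valid as soon as `r(C) ⊆ r(D)`.
The condition that the range lie in `r(D)` is clopen, so `B` can be cut into such pieces `C`. -/
theorem steinbergComponent_mul_le (hc : IsContinuousCocycle c)
    (h : ∀ (α : Γ) (x : G), ∃ y, c y = α ∧ rng y = rng x) (α β : Γ) :
    (steinbergComponent c (α * β)).toAddSubgroup
      ≤ productSubgroup (steinbergComponent c α).toAddSubgroup
        (steinbergComponent c β).toAddSubgroup := by
  refine steinbergComponent_le hc (productSubmodule c α β) fun B hB hBc => ?_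
  set N := (productSubmodule c α β).map (Steinberg G).subtype with hN
  have key : charFun B ∈ N.toAddSubgroup := by
    refine charFun_mem_of_isCompact hB.isCompact _ fun x _ => ?_
    obtain ⟨y, rfl, hyx⟩ := h α x
    obtain ⟨D, hD, hyD, hDc⟩ := exists_isCompactOpenBisection_subset hc y
    refine ⟨_, isClopen_rng_saturation hD, ⟨y, hyD, hyx⟩, fun T hT => ?_⟩
    set C := B ∩ ({x | ∃ y ∈ D, rng y = rng x} ∩ T) with hC
    have hCb : IsCompactOpenBisection C := hB.inter_isClopen ((isClopen_rng_saturation hD).inter hT)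
    have hE := hD.setInv.setMul hCb
    have hEc : setMul (setInv D) C ⊆ c ⁻¹' {β} := by
      rintro _ ⟨d, hd, z, hz, hdz, rfl⟩
      have h1 : c (inv d) = c y := hDc hd
      have h2 : c z = c y * β := hBc hz.1
      rw [hc.map_inv] at h1
      simp only [Set.mem_preimage, Set.mem_singleton_iff]
      rw [hc.map_mul d z hdz, h2, ← h1, _root_.mul_inv_cancel_left]
    refine ⟨_, AddSubgroup.subset_closure ⟨_, charFun_mem_steinbergComponent hD hDc, _,
      charFun_mem_steinbergComponent hE hEc, rfl⟩, ?_⟩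
    refine (conv_charFun_charFun hD _).trans (congrArg charFun ?_)
    ext z
    constructor
    · intro hz
      obtain ⟨d, hd, _, ⟨e, he, b, hb, heb, rfl⟩, hdw, rfl⟩ := hz
      -- Both arrows lie in `D` and are composable with the same arrow, so injectivity of the source
      -- on `D` gives `DD⁻¹C ⊆ C`.
      have hed : inv e = d := hD.injOn_src he hd (by rw [src_inv, hdw, rng_mul e b heb])
      rwa [← hed, inv_mul_cancel_left e b heb]
    · intro hz
      obtain ⟨d, hd, hdz⟩ := hz.2.1
      exact mem_setMul_iff.2 ⟨d, hd, hdz, inv d, by simpa [setInv, inv_inv] using hd, z, hz,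
        by rw [src_inv, hdz], rfl⟩
  obtain ⟨g, hg, hgf⟩ := key
  rwa [← show g = ⟨charFun B, charFun_mem hB⟩ from Subtype.ext hgf]

theorem isStronglyGradedRing_of_rng (hc : IsContinuousCocycle c)
    (h : ∀ (α : Γ) (x : G), ∃ y, c y = α ∧ rng y = rng x) :
    IsStronglyGradedRing fun γ => (steinbergComponent c γ).toAddSubgroup where
  __ := isGradedRing_steinbergComponent hc
  mul_eq α β := le_antisymm (productSubgroup_steinbergComponent_le hc α β)
    (steinbergComponent_mul_le hc h α β)

end SteinbergGrading

/-! ### The grading of the reduced C*-algebra. -/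

section ReducedGrading

variable {G Γ : Type*} [TopologicalSpace G] [TopGroupoid G] [IsAmple G] [T2Space (units G)]

/-- The functional `T ↦ (T ξ)(x)` on the reduced C*-algebra. -/
noncomputable def reducedEval (ξ : Hilb G) (x : G) : ReducedCStar G →L[ℂ] ℂ where
  toFun T := (T : Hilb G →L[ℂ] Hilb G) ξ x
  map_add' _ _ := rfl
  map_smul' _ _ := rfl
  cont := ((lp.evalCLM ℂ (fun _ : G => ℂ) 2 x).continuous.comp
    (ContinuousLinearMap.apply ℂ (Hilb G) ξ).continuous).comp continuous_subtype_val

theorem reducedEval_toReduced (ξ : Hilb G) (x : G) (f : Steinberg G) :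
    reducedEval ξ x (toReduced G f) = conv (f : G → ℂ) ξ x := rfl

theorem toReduced_mul (f g : Steinberg G) :
    toReduced G (f * g) = toReduced G f * toReduced G g :=
  Subtype.ext (map_mul (regRep G) f g)

theorem toReduced_star (f : Steinberg G) : toReduced G (star f) = star (toReduced G f) :=
  Subtype.ext (map_star (regRep G) f)

theorem denseRange_toReduced : DenseRange (toReduced G) := by
  intro T
  rw [closure_subtype]
  have h : Subtype.val '' Set.range (toReduced G) = Set.range (regRep G) := by
    rw [← Set.range_comp]
    rfl
  rw [h]
  exact T.2

open Classical in
-- A bounded operator on `ℓ²(G)` is determined by its values on the basis vectors `δ_z`, hence by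
-- its matrix coefficients.
theorem eq_zero_of_reducedEval {T : ReducedCStar G}
    (h : ∀ x z : G, reducedEval (lp.single 2 z 1) x T = 0) : T = 0 := by
  refine Subtype.ext (lp.ext_continuousLinearMap (by norm_num) fun z => ?_)
  ext x
  exact h x z

variable {c : G → Γ}

theorem reducedComponent_induction {γ : Γ} {p : ReducedCStar G → Prop}
    (hp : IsClosed {T | p T}) (h : ∀ f ∈ steinbergComponent c γ, p (toReduced G f))
    {T : ReducedCStar G} (hT : T ∈ reducedComponent c γ) : p T := by
  refine closure_minimal (s := toReduced G '' steinbergComponent c γ) ?_ hp hT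
  rintro _ ⟨f, hf, rfl⟩
  exact h f hf

theorem toReduced_mem_reducedComponent {γ : Γ} {f : Steinberg G}
    (hf : f ∈ steinbergComponent c γ) : toReduced G f ∈ reducedComponent c γ :=
  subset_closure ⟨f, hf, rfl⟩

variable [Group Γ] [TopologicalSpace Γ]

open Classical in
-- For `f` in `A(G)_γ`, a nonzero coefficient at `(x, z)` forces `z = y⁻¹x` for some `y` in the
-- support of `f`, so `c(z) = γ⁻¹c(x)`. Vanishing of a coefficient is a closed condition, so the
-- conclusion survives the closure.
theorem eq_mul_of_reducedEval_single_ne_zero (hc : IsContinuousCocycle c) {γ : Γ}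
    {T : ReducedCStar G} (hT : T ∈ reducedComponent c γ) {x z : G}
    (h : reducedEval (lp.single 2 z 1) x T ≠ 0) : c x * (c z)⁻¹ = γ := by
  contrapose! h
  refine reducedComponent_induction
    (isClosed_eq (reducedEval _ x).continuous continuous_const) (fun f hf => ?_) hT
  rw [reducedEval_toReduced]
  contrapose! h
  obtain ⟨y, hyx, hfy, hy⟩ := exists_of_conv_ne_zero h
  have hz : mul (inv y) x = z := by
    by_contra hz
    exact hy (lp.single_apply_ne 2 z 1 hz)
  have hγ : c y = γ := hf hfy
  rw [← hz, hc.map_mul _ _ (by rw [src_inv, hyx]), hc.map_inv, hγ]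
  simp

theorem isGradedCStarAlgebra_reducedComponent [DiscreteTopology Γ] (hc : IsContinuousCocycle c) :
    IsGradedCStarAlgebra fun γ => reducedComponent c γ where
  isClosed γ := Submodule.isClosed_topologicalClosure _
  linearIndependent := by
    classical
    exact iSupIndep_of_functionals
      (fun p : G × G => (reducedEval (lp.single 2 p.2 1) p.1 : ReducedCStar G →ₗ[ℂ] ℂ))
      (fun p => c p.1 * (c p.2)⁻¹)
      (fun γ T hT p hp => eq_mul_of_reducedEval_single_ne_zero hc hT hp)
      fun T hT => eq_zero_of_reducedEval fun x z => hT (x, z)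
  mul_le α β := by
    refine Submodule.span_le.2 ?_
    rintro _ ⟨S, hS, T, hT, rfl⟩
    refine map_mem_closure₂ continuous_mul hS hT ?_
    rintro _ ⟨f, hf, rfl⟩ _ ⟨g, hg, rfl⟩
    exact ⟨f * g, productSubgroup_steinbergComponent_le hc α β
      (AddSubgroup.subset_closure ⟨f, hf, g, hg, rfl⟩), toReduced_mul f g⟩
  star_mem γ T hT := by
    refine map_mem_closure continuous_star hT ?_
    rintro _ ⟨f, hf, rfl⟩
    refine ⟨star f, fun x hx => ?_, toReduced_star f⟩
    have hx' : (f : G → ℂ) (inv x) ≠ 0 := fun h => hx (by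
      rw [Steinberg.coe_star, invol, h, star_zero])
    have := hf hx'
    simp only [Set.mem_preimage, Set.mem_singleton_iff, hc.map_inv] at this ⊢
    rw [← this, _root_.inv_inv]
  dense := by
    refine (denseRange_toReduced (G := G)).mono ?_
    rintro _ ⟨f, rfl⟩
    have hf : f ∈ ⨆ γ, steinbergComponent c γ := by
      rw [iSup_steinbergComponent hc]
      trivial
    have hle : (⨆ γ, steinbergComponent c γ) ≤
        (⨆ γ, reducedComponent c γ).comap (toReduced G) :=
      iSup_le fun γ f hf => Submodule.mem_iSup_of_mem γ (toReduced_mem_reducedComponent hf)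
    exact hle hf

theorem isStronglyGradedCStarAlgebra_of_isStronglyGradedRing [DiscreteTopology Γ]
    (hc : IsContinuousCocycle c)
    (h : IsStronglyGradedRing fun γ => (steinbergComponent c γ).toAddSubgroup) :
    IsStronglyGradedCStarAlgebra fun γ => reducedComponent c γ where
  __ := isGradedCStarAlgebra_reducedComponent hc
  subset_closure α β := by
    -- The component of degree `αβ` is by construction the closure of the image of `A(G)_{αβ}`, so
    -- only that image has to be treated.
    refine closure_mono ?_
    rintro _ ⟨f, hf, rfl⟩
    replace hf : f ∈ (steinbergComponent c (α * β)).toAddSubgroup := hf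
    rw [← h.mul_eq α β] at hf
    change toReduced G f ∈ productSpan (reducedComponent c α) (reducedComponent c β)
    induction hf using AddSubgroup.closure_induction with
    | mem f hf =>
      obtain ⟨g, hg, k, hk, rfl⟩ := hf
      rw [toReduced_mul]
      exact Submodule.subset_span ⟨_, toReduced_mem_reducedComponent hg, _,
        toReduced_mem_reducedComponent hk, rfl⟩
    | zero => rw [map_zero]; exact Submodule.zero_mem _
    | add f g _ _ hf hg => rw [map_add]; exact Submodule.add_mem _ hf hg
    | neg f _ hf => rw [map_neg]; exact Submodule.neg_mem _ hf

theorem exists_rng_of_isStronglyGradedCStarAlgebra [DiscreteTopology Γ]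
    (hc : IsContinuousCocycle c)
    (h : IsStronglyGradedCStarAlgebra fun γ => reducedComponent c γ) (α : Γ) (x : G) :
    ∃ y, c y = α ∧ rng y = rng x := by
  classical
  by_contra! hne
  -- The test element `1_B` is supported near the unit `r(x)` and has degree `1`, read as `αα⁻¹`.
  obtain ⟨B, hB, hxB, hBc⟩ := exists_isCompactOpenBisection_subset hc (rng x)
  rw [hc.map_rng, ← mul_inv_cancel α] at hBc
  -- All vectors `ξ` are needed, not only basis vectors: a product is evaluated as `(ST)δ = S(Tδ)`,
  -- with `Tδ` arbitrary.
  have hvanish : ∀ S ∈ reducedComponent c α, ∀ ξ, reducedEval ξ (rng x) S = 0 := by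
    intro S hS ξ
    refine reducedComponent_induction
      (isClosed_eq (reducedEval ξ (rng x)).continuous continuous_const) (fun f hf => ?_) hS
    rw [reducedEval_toReduced]
    by_contra h0
    obtain ⟨y, hyx, hfy, -⟩ := exists_of_conv_ne_zero h0
    rw [rng_rng] at hyx
    exact hne y (hf hfy) hyx
  have hle : productSpan (reducedComponent c α) (reducedComponent c α⁻¹) ≤
      (reducedEval (lp.single 2 (rng x) 1) (rng x) : ReducedCStar G →ₗ[ℂ] ℂ).ker := by
    refine Submodule.span_le.2 ?_
    rintro _ ⟨S, hS, T, -, rfl⟩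
    exact hvanish S hS _
  have hmem := h.subset_closure α α⁻¹
    (toReduced_mem_reducedComponent (charFun_mem_steinbergComponent hB hBc))
  have h0 : reducedEval (lp.single 2 (rng x) 1) (rng x)
      (toReduced G ⟨charFun B, charFun_mem hB⟩) = 0 :=
    closure_minimal hle (isClosed_eq (reducedEval _ _).continuous continuous_const) hmem
  -- With `u = r(x)` in `B`, the coefficient of `1_B` at `(u, u)` is `δ_u(u⁻¹u) = 1`.
  rw [reducedEval_toReduced, conv_charFun_of_mem hB _ hxB rfl, inv_mul, src_rng,
    lp.single_apply_self] at h0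
  exact one_ne_zero h0

end ReducedGrading

end TopGroupoid

/-! ### The cycle of implications. -/

theorem mainTheorem2 {G Γ : Type*} [TopologicalSpace G] [TopGroupoid G] [TopGroupoid.IsAmple G]
    [T2Space (TopGroupoid.units G)] [Group Γ] [TopologicalSpace Γ] [DiscreteTopology Γ]
    (c : G → Γ)
    (hc : TopGroupoid.IsContinuousCocycle c) :
    List.TFAE [
      TopGroupoid.IsStronglyGradedGroupoid c,
      IsStronglyGradedRing
        (fun γ : Γ => (TopGroupoid.steinbergComponent c γ).toAddSubgroup),
      IsStronglyGradedCStarAlgebra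
        (fun γ : Γ => TopGroupoid.reducedComponent c γ)] := by
  tfae_have 1 → 2 := fun h =>
    TopGroupoid.isStronglyGradedRing_of_rng hc (hc.isStronglyGradedGroupoid_iff.1 h)
  tfae_have 2 → 3 := TopGroupoid.isStronglyGradedCStarAlgebra_of_isStronglyGradedRing hc
  tfae_have 3 → 1 := fun h => hc.isStronglyGradedGroupoid_iff.2
    (TopGroupoid.exists_rng_of_isStronglyGradedCStarAlgebra hc h)
  tfae_finish
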